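/- Model. For $\rho\in[0,1]$, a pair $(a,b)$ of $\pm1$-valued random variables is a pair of $\rho$-correlated uniform bits if $\mathbb E[a]=\mathbb E[b]=0$ and $\mathbb E[ab]=\rho$. In a protocol with $\rho$-correlated randomness, Alice holds an input $x\in\{0,1\}^n$ and a string $r\in\{\pm1\}^m$, Bob holds an input $y\in\{0,1\}^n$ and a string $r'\in\{\pm1\}^m$ ($m$ arbitrary), where the pairs $(r_i,r'_i)$ are independent pairs of $\rho$-correlated uniform bits, independent of the inputs. In each round a player determined by the transcript so far sends one bit, a function of that player's input, random string and the transcript; when the communication ends, as determined by the transcript, Bob outputs a bit, a function of $y$, $r'$ and the transcript. The cost of the protocol is the maximum over all $x,y\in\{0,1\}^n$ of the expected number of bits communicated. The protocol is one-way if only Alice sends bits. The case $\rho=1$ is perfectly shared randomness. A promise problem $P=(P_n)_{n\ge1}$ consists of disjoint sets $P_n^{\mathrm{yes}},P_n^{\mathrm{no}}\subseteq\{0,1\}^n\times\{0,1\}^n$ for each $n\geq 1$. A protocol on $n$-bit inputs solves $P_n$ if it outputs $1$ with probability at least $2/3$ on each $(x,y)\in P_n^{\mathrm{yes}}$ and $0$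 with probability at least $2/3$ on each $(x,y)\in P_n^{\mathrm{no}}$. Let $\mathrm{PSR\text{-}CC}(k)$ be the class of promise problems $P$ such that for every $n$ there is a (two-way) protocol with perfectly shared randomness that solves $P_n$ at cost at most $k$, and let $\mathrm{OW\text{-}ISR\text{-}CC}_\rho(k)$ be the class of those $P$ such that for every $n$ there is a one-way protocol with $\rho$-correlated randomness that solves $P_n$ at cost at most $k$. Theorem. For every $\rho\in(0,1]$ there is a finite constant $c\in\mathbb N$, depending only on $\rho$, such that for every integer $k\ge0$, $$\mathrm{PSR\text{-}CC}(k)\subseteq \mathrm{OW\text{-}ISR\text{-}CC}_\rho(c^k).$$ -/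

import Mathlib

namespace CommCC

/-- A promise problem `P = (P_n)_n` on pairs of `n`-bit inputs: for each `n ≥ 1`, disjoint sets of
yes-instances and no-instances. -/
structure PromiseProblem where
  yes : (n : ℕ+) → Set ((Fin n → Bool) × (Fin n → Bool))
  no : (n : ℕ+) → Set ((Fin n → Bool) × (Fin n → Bool))
  disjoint : ∀ n, Disjoint (yes n) (no n)

/-- Deterministic two-party protocol trees. Alice sees a value in `A` and Bob a value in `B` (below:
input together with random string). At each inner node one of the players, determined by the
transcript so far, sends one bit; at a leaf the communication is over and Bob produces the output
from what he sees and the transcript. -/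
inductive Protocol (A B : Type) : Type where
  | output (out : B → Bool) : Protocol A B
  | alice (msg : A → Bool) (next : Bool → Protocol A B) : Protocol A B
  | bob (msg : B → Bool) (next : Bool → Protocol A B) : Protocol A B

namespace Protocol

variable {A B : Type}

/-- The output of the interaction on `(a, b)`. -/
def run : Protocol A B → A → B → Bool
  | output out, _, b => out b
  | alice msg next, a, b => (next (msg a)).run a b
  | bob msg next, a, b => (next (msg b)).run a b

/-- The number of bits communicated on `(a, b)`. -/
def bits : Protocol A B → A → B → ℕ
  | output _, _, _ => 0
  | alice msg next, a, b => (next (msg a)).bits a b + 1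
  | bob msg next, a, b => (next (msg b)).bits a b + 1

/-- A protocol is one-way if only Alice ever sends bits. -/
def OneWay : Protocol A B → Prop
  | output _ => True
  | alice _ next => ∀ t, (next t).OneWay
  | bob _ _ => False

end Protocol

/-- The joint probability mass function of a pair of `ρ`-correlated uniform `±1` bits, that is, the
only one with `E[a] = E[b] = 0` and `E[a b] = ρ`. -/
noncomputable def bitWeight (ρ : ℝ) (a b : ℤˣ) : ℝ :=
  (1 + ρ * (((a : ℤ) : ℝ) * ((b : ℤ) : ℝ))) / 4

/-- The expectation of `f (r, r')`, where `(r, r')` is a pair of `m`-bit strings whose coordinate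
pairs `(r i, r' i)` are independent pairs of `ρ`-correlated uniform bits. -/
noncomputable def corrExpect (ρ : ℝ) (m : ℕ) (f : (Fin m → ℤˣ) → (Fin m → ℤˣ) → ℝ) : ℝ :=
  ∑ r : Fin m → ℤˣ, ∑ r' : Fin m → ℤˣ, (∏ i, bitWeight ρ (r i) (r' i)) * f r r'

open scoped Classical in
/-- The probability of the event `E (r, r')` under the same distribution. -/
noncomputable def corrProb (ρ : ℝ) (m : ℕ) (E : (Fin m → ℤˣ) → (Fin m → ℤˣ) → Prop) : ℝ :=
  corrExpect ρ m fun r r' => if E r r' then 1 else 0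

/-- A protocol on `n`-bit inputs in which Alice and Bob each hold an `m`-bit random string. -/
abbrev RandProtocol (n m : ℕ) : Type :=
  Protocol ((Fin n → Bool) × (Fin m → ℤˣ)) ((Fin n → Bool) × (Fin m → ℤˣ))

namespace RandProtocol

variable {n m : ℕ}

/-- With `ρ`-correlated bits, the output is correct with probability at least `2/3` on every
yes-instance and on every no-instance. -/
def Solves (ρ : ℝ) (Q : RandProtocol n m) (Y N : Set ((Fin n → Bool) × (Fin n → Bool))) : Prop :=
  (∀ x y, (x, y) ∈ Y → 2 / 3 ≤ corrProb ρ m fun r r' => Q.run (x, r) (y, r') = true) ∧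
  (∀ x y, (x, y) ∈ N → 2 / 3 ≤ corrProb ρ m fun r r' => Q.run (x, r) (y, r') = false)

/-- With `ρ`-correlated bits, the maximum over all inputs of the expected number of bits
communicated is at most `k`. -/
def CostLE (ρ : ℝ) (Q : RandProtocol n m) (k : ℕ) : Prop :=
  ∀ x y, corrExpect ρ m (fun r r' => (Q.bits (x, r) (y, r') : ℝ)) ≤ k

end RandProtocol

/-- Promise problems with two-way communication complexity at most `k` with access to
`ρ`-correlated bits (arbitrarily many of them). -/
def isrCC (ρ : ℝ) (k : ℕ) : Set PromiseProblem :=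
  {P | ∀ n : ℕ+, ∃ (m : ℕ) (Q : RandProtocol n m),
    Q.Solves ρ (P.yes n) (P.no n) ∧ Q.CostLE ρ k}

/-- The same for one-way communication from Alice to Bob. -/
def owIsrCC (ρ : ℝ) (k : ℕ) : Set PromiseProblem :=
  {P | ∀ n : ℕ+, ∃ (m : ℕ) (Q : RandProtocol n m),
    Q.OneWay ∧ Q.Solves ρ (P.yes n) (P.no n) ∧ Q.CostLE ρ k}

/-- Promise problems with two-way communication complexity at most `k` with perfectly shared
randomness. -/
def psrCC (k : ℕ) : Set PromiseProblem := isrCC 1 k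

end CommCC

/-!
Fix a two-way protocol of expected cost `k ≥ 1` with shared string `R ∈ {±1}ᵐ`, and let `p (x, y)`
be the probability that it accepts after at most `d = 10 k` bits. By Markov's inequality `p` is at
least `17 / 30` on yes-instances, and it is at most `1 / 3` on no-instances. Each of the at most
`2 ^ d` leaves of depth at most `d` is reached on a combinatorial rectangle
(`Protocol.exists_shortAccept_eq_sum`), so `2ᵐ p (x, y) = ⟨U x, V y⟩` for `0`-`1` vectors `U x`,
known to Alice, and `V y`, known to Bob, indexed by the at most `2ᵐ 2 ^ d` pairs of a string and a
leaf. It remains to decide by one-way communication whether an inner product is large.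

Let `D` be the index set, `N` its size and `u = 2 U x - 1`, a vector of signs. Given `ρ`-correlated
sign vectors `r`, `r'` on `D`, Alice sends the single bit `s = sign ⟨u, r⟩` and Bob computes
`b = ⟨V y, r'⟩`. Because all entries of `u` are signs, symmetry shows that every coordinate `r e`
has the same correlation with `s` up to the factor `u e` (`sum_signOf_sum_mul_mul`), so that
`E[s b] = ρ κ ⟨u, V y⟩` exactly, with `κ = E|r₁ + ⋯ + r_N| / N`
(`sum_pairWeight_mul_blockValue`). From `⟨u, V y⟩ = 2 ⟨U x, V y⟩ - ∑ V y` Bob recovers the inner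
product. The fourth moment of a sum of signs gives `κ ≥ 1 / (4 √N)` (`le_majorityBias`), while
`E[(s b) ^ 2] ≤ N`. By Chebyshev's inequality (`chebyshev_blockValue`), repeating this `T` times
independently with `T ≥ 1200 · 4 ^ d / ρ ^ 2` gives the correct answer with probability at least
`2 / 3`, and `T = c ^ k` bits suffice for a constant `c` depending on `ρ` only. In the case `k = 0`
nothing is ever sent, and the correlation plays no role.
-/

open Finset

namespace CommCC

/-! ### Finite product spaces and correlated bits -/

/-- The mean of a product of two variables, each depending on one coordinate of a finite product
space; for distinct coordinates it vanishes as soon as one of the variables is centred. -/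
theorem sum_pi_prod_mul_mul {I Ω : Type*} [Fintype I] [DecidableEq I] [Fintype Ω]
    (w : Ω → ℝ) (hw : ∑ ω, w ω = 1) (f g : Ω → ℝ) (i j : I) (hf : ∑ ω, w ω * f ω = 0) :
    ∑ z : I → Ω, (∏ l, w (z l)) * (f (z i) * g (z j)) =
      if i = j then ∑ ω, w ω * (f ω * g ω) else 0 := by
  have key : ∀ z : I → Ω, (∏ l, w (z l)) * (f (z i) * g (z j)) =
      ∏ l, (w (z l) * ((if l = i then f (z l) else 1) * (if l = j then g (z l) else 1))) := by
    intro z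
    rw [Finset.prod_mul_distrib, Finset.prod_mul_distrib]
    simp
  simp_rw [key]
  rw [← Fintype.prod_sum (fun l ω => w ω * ((if l = i then f ω else 1) * (if l = j then g ω else 1)))]
  split_ifs with h
  · subst h
    rw [Finset.prod_eq_single i]
    · simp
    · intro l _ hl
      simp [hl, hw]
    · simp
  · apply Finset.prod_eq_zero (Finset.mem_univ i)
    simp [h, hf]

/-- The second moment of a sum of independent centred variables on a finite product space. -/
theorem sum_pi_prod_mul_sum_sq {I Ω : Type*} [Fintype I] [DecidableEq I] [Fintype Ω]
    (w : Ω → ℝ) (hw : ∑ ω, w ω = 1) (X : I → Ω → ℝ) (hX : ∀ i, ∑ ω, w ω * X i ω = 0) :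
    ∑ z : I → Ω, (∏ l, w (z l)) * (∑ i, X i (z i)) ^ 2 = ∑ i, ∑ ω, w ω * X i ω ^ 2 := by
  simp_rw [sq, Finset.sum_mul_sum, Finset.mul_sum]
  rw [Finset.sum_comm]
  refine Finset.sum_congr rfl fun i _ => ?_
  rw [Finset.sum_comm]
  simp_rw [fun j => sum_pi_prod_mul_mul w hw (X i) (X j) i j (hX i)]
  simp

theorem bitWeight_nonneg {ρ : ℝ} (h0 : 0 ≤ ρ) (h1 : ρ ≤ 1) (a b : ℤˣ) : 0 ≤ bitWeight ρ a b := by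
  unfold bitWeight
  rcases Int.units_eq_one_or a with rfl | rfl <;> rcases Int.units_eq_one_or b with rfl | rfl <;>
    norm_num <;> linarith

theorem sum_intUnits (f : ℤˣ → ℝ) : ∑ s, f s = f 1 + f (-1) := by
  rw [show (univ : Finset ℤˣ) = {1, -1} from rfl, Finset.sum_pair (by decide)]

theorem sum_bitWeight_right (ρ : ℝ) (a : ℤˣ) : ∑ b, bitWeight ρ a b = 1 / 2 := by
  rw [sum_intUnits]; simp [bitWeight]; ring

theorem sum_bitWeight_left (ρ : ℝ) (b : ℤˣ) : ∑ a, bitWeight ρ a b = 1 / 2 := by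
  rw [sum_intUnits]; simp [bitWeight]; ring

theorem sum_bitWeight_mul (ρ : ℝ) (a : ℤˣ) :
    ∑ b, bitWeight ρ a b * ((b : ℤ) : ℝ) = 1 / 2 * (ρ * ((a : ℤ) : ℝ)) := by
  rw [sum_intUnits]; simp [bitWeight]; ring

/-- The joint mass function of two sign vectors with independent `ρ`-correlated coordinate pairs. -/
noncomputable def pairWeight {D : Type*} [Fintype D] (ρ : ℝ) (r r' : D → ℤˣ) : ℝ :=
  ∏ e, bitWeight ρ (r e) (r' e)

section PairWeight

variable {D : Type*} [Fintype D]

theorem pairWeight_nonneg {ρ : ℝ} (h0 : 0 ≤ ρ) (h1 : ρ ≤ 1) (r r' : D → ℤˣ) :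
    0 ≤ pairWeight ρ r r' :=
  Finset.prod_nonneg fun _ _ => bitWeight_nonneg h0 h1 _ _

theorem sum_pairWeight_right [DecidableEq D] (ρ : ℝ) (r : D → ℤˣ) :
    ∑ r', pairWeight ρ r r' = (1 / 2) ^ Fintype.card D := by
  unfold pairWeight
  rw [← Fintype.prod_sum (fun e b => bitWeight ρ (r e) b)]
  simp_rw [sum_bitWeight_right, Finset.prod_const, Finset.card_univ]

theorem sum_pairWeight_left [DecidableEq D] (ρ : ℝ) (r' : D → ℤˣ) :
    ∑ r, pairWeight ρ r r' = (1 / 2) ^ Fintype.card D := by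
  unfold pairWeight
  rw [← Fintype.prod_sum (fun e a => bitWeight ρ a (r' e))]
  simp_rw [sum_bitWeight_left, Finset.prod_const, Finset.card_univ]

/-- Given `r`, the conditional mean of `r' e` is `ρ * r e`. -/
theorem sum_pairWeight_mul [DecidableEq D] (ρ : ℝ) (r : D → ℤˣ) (e : D) :
    ∑ r', pairWeight ρ r r' * ((r' e : ℤ) : ℝ) =
      (1 / 2) ^ Fintype.card D * (ρ * ((r e : ℤ) : ℝ)) := by
  have key : ∀ r' : D → ℤˣ, pairWeight ρ r r' * ((r' e : ℤ) : ℝ) =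
      ∏ l, (bitWeight ρ (r l) (r' l) * (if l = e then ((r' l : ℤ) : ℝ) else 1)) := by
    intro r'
    rw [Finset.prod_mul_distrib]
    simp [pairWeight]
  have fac : ∀ l, ∑ b, bitWeight ρ (r l) b * (if l = e then ((b : ℤ) : ℝ) else 1) =
      1 / 2 * (if l = e then ρ * ((r l : ℤ) : ℝ) else 1) := by
    intro l
    split_ifs
    · exact sum_bitWeight_mul ρ (r l)
    · simpa using sum_bitWeight_right ρ (r l)
  simp_rw [key]
  rw [← Fintype.prod_sum
    (fun l b => bitWeight ρ (r l) b * (if l = e then ((b : ℤ) : ℝ) else 1))]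
  simp_rw [fac]
  rw [Finset.prod_mul_distrib]
  simp

theorem pairWeight_one (r r' : D → ℤˣ) :
    pairWeight 1 r r' = if r' = r then (1 / 2) ^ Fintype.card D else 0 := by
  split_ifs with h
  · subst h
    have : ∀ e, bitWeight 1 (r' e) (r' e) = 1 / 2 := fun e => by
      rcases Int.units_eq_one_or (r' e) with h | h <;> rw [h] <;> norm_num [bitWeight]
    simp [pairWeight, this]
  · obtain ⟨e, he⟩ := Function.ne_iff.mp h
    apply Finset.prod_eq_zero (Finset.mem_univ e)
    rcases Int.units_eq_one_or (r e) with h | h <;> rcases Int.units_eq_one_or (r' e) with h' | h' <;>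
      simp_all [bitWeight]

end PairWeight

section CorrExpect

variable {ρ : ℝ} {m : ℕ}

theorem corrExpect_eq (f : (Fin m → ℤˣ) → (Fin m → ℤˣ) → ℝ) :
    corrExpect ρ m f = ∑ r, ∑ r', pairWeight ρ r r' * f r r' := rfl

theorem corrExpect_mono (h0 : 0 ≤ ρ) (h1 : ρ ≤ 1) {f g : (Fin m → ℤˣ) → (Fin m → ℤˣ) → ℝ}
    (h : ∀ r r', f r r' ≤ g r r') : corrExpect ρ m f ≤ corrExpect ρ m g :=
  Finset.sum_le_sum fun r _ => Finset.sum_le_sum fun r' _ =>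
    mul_le_mul_of_nonneg_left (h r r') (pairWeight_nonneg h0 h1 r r')

theorem corrExpect_sub (f g : (Fin m → ℤˣ) → (Fin m → ℤˣ) → ℝ) :
    corrExpect ρ m (fun r r' => f r r' - g r r') = corrExpect ρ m f - corrExpect ρ m g := by
  simp [corrExpect, mul_sub, Finset.sum_sub_distrib]

theorem corrExpect_div (f : (Fin m → ℤˣ) → (Fin m → ℤˣ) → ℝ) (c : ℝ) :
    corrExpect ρ m (fun r r' => f r r' / c) = corrExpect ρ m f / c := by
  simp [corrExpect, mul_div_assoc, Finset.sum_div]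

/-- The second string is uniformly distributed, whatever the correlation. -/
theorem corrExpect_snd (g : (Fin m → ℤˣ) → ℝ) :
    corrExpect ρ m (fun _ r' => g r') = ∑ r', (1 / 2) ^ m * g r' := by
  rw [corrExpect_eq, Finset.sum_comm]
  refine Finset.sum_congr rfl fun r' _ => ?_
  rw [← Finset.sum_mul, sum_pairWeight_left, Fintype.card_fin]

theorem corrExpect_const (c : ℝ) : corrExpect ρ m (fun _ _ => c) = c := by
  rw [corrExpect_snd fun _ => c, Finset.sum_const, Finset.card_univ, nsmul_eq_mul]
  simp

theorem corrExpect_one (f : (Fin m → ℤˣ) → (Fin m → ℤˣ) → ℝ) :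
    corrExpect 1 m f = ∑ r, (1 / 2) ^ m * f r r := by
  simp [corrExpect_eq, pairWeight_one, ite_mul]

/-- Cutting the correlated strings into blocks gives independent pairs of correlated blocks. -/
theorem corrExpect_blocks {T D : Type*} [Fintype T] [Fintype D] [DecidableEq T] [DecidableEq D]
    (e : T × D ≃ Fin m) (f : (T → (D → ℤˣ) × (D → ℤˣ)) → ℝ) :
    corrExpect ρ m (fun r r' => f fun j => (fun d => r (e (j, d)), fun d => r' (e (j, d)))) =
      ∑ z : T → (D → ℤˣ) × (D → ℤˣ), (∏ j, pairWeight ρ (z j).1 (z j).2) * f z := by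
  rw [corrExpect, ← Fintype.sum_prod_type'
    (f := fun r r' : Fin m → ℤˣ => (∏ i, bitWeight ρ (r i) (r' i)) *
      f fun j => (fun d => r (e (j, d)), fun d => r' (e (j, d))))]
  let E : ((Fin m → ℤˣ) × (Fin m → ℤˣ)) ≃ (T → (D → ℤˣ) × (D → ℤˣ)) :=
    { toFun := fun p j => (fun d => p.1 (e (j, d)), fun d => p.2 (e (j, d)))
      invFun := fun z => (fun i => (z (e.symm i).1).1 (e.symm i).2,
        fun i => (z (e.symm i).1).2 (e.symm i).2)
      left_inv := fun p => by simp
      right_inv := fun z => by simp }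
  refine Fintype.sum_equiv E _ _ fun p => ?_
  congr 1
  rw [← e.prod_comp, Fintype.prod_prod_type]
  rfl

end CorrExpect

/-! ### Sums of signs and the value of a block -/

/-- The sign of a real number, with the value `1` at `0`. -/
noncomputable def signOf (t : ℝ) : ℝ := if 0 ≤ t then 1 else -1

theorem signOf_mul_self (t : ℝ) : signOf t * t = |t| := by
  unfold signOf
  split_ifs with h
  · rw [one_mul, abs_of_nonneg h]
  · rw [abs_of_neg (not_le.mp h)]; ring

theorem signOf_sq (t : ℝ) : signOf t ^ 2 = 1 := by
  unfold signOf
  split_ifs <;> norm_num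

/-- The second moment of a weighted sum of independent uniform signs. -/
theorem sum_sum_sq {D : Type*} [Fintype D] [DecidableEq D] (V : D → ℝ) :
    ∑ r : D → ℤˣ, (1 / 2) ^ Fintype.card D * (∑ e, V e * ((r e : ℤ) : ℝ)) ^ 2 = ∑ e, V e ^ 2 := by
  have h := sum_pi_prod_mul_sum_sq (I := D) (Ω := ℤˣ) (fun _ => 1 / 2)
    (by rw [sum_intUnits]; norm_num) (fun e s => V e * ((s : ℤ) : ℝ))
    (fun e => by rw [sum_intUnits]; simp)
  simp only [Finset.prod_const, Finset.card_univ] at h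
  rw [h]
  refine Finset.sum_congr rfl fun e _ => ?_
  rw [sum_intUnits]; simp; ring

/-- The fourth moment of a sum of `n` independent uniform signs. -/
theorem sum_fin_sum_pow_four (n : ℕ) :
    ∑ r : Fin n → ℤˣ, (1 / 2) ^ n * (∑ e, ((r e : ℤ) : ℝ)) ^ 4 = 3 * (n : ℝ) ^ 2 - 2 * n := by
  induction n with
  | zero => simp
  | succ n ih =>
    have h2 := sum_sum_sq (D := Fin n) (fun _ => 1)
    have h0 : ∑ r : Fin n → ℤˣ, ((1 : ℝ) / 2) ^ n = 1 := by simp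
    simp only [Fintype.card_fin, one_mul, one_pow, Finset.sum_const, Finset.card_univ,
      nsmul_eq_mul, mul_one] at h2
    rw [← (Fin.consEquiv fun _ => ℤˣ).sum_comp, Fintype.sum_prod_type, sum_intUnits]
    simp only [Fin.consEquiv_apply, Fin.sum_univ_succ, Fin.cons_zero, Fin.cons_succ]
    rw [← Finset.sum_add_distrib]
    have key : ∀ r : Fin n → ℤˣ,
        (1 / 2 : ℝ) ^ (n + 1) * ((((1 : ℤˣ) : ℤ) : ℝ) + ∑ e, ((r e : ℤ) : ℝ)) ^ 4 +
          (1 / 2) ^ (n + 1) * ((((-1 : ℤˣ) : ℤ) : ℝ) + ∑ e, ((r e : ℤ) : ℝ)) ^ 4 =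
        (1 / 2) ^ n * (∑ e, ((r e : ℤ) : ℝ)) ^ 4 +
          6 * ((1 / 2) ^ n * (∑ e, ((r e : ℤ) : ℝ)) ^ 2) + (1 / 2) ^ n := by
      intro r
      push_cast
      ring
    simp_rw [key]
    rw [Finset.sum_add_distrib, Finset.sum_add_distrib, ih, ← Finset.mul_sum, h2, h0]
    push_cast
    ring

theorem sum_sum_pow_four (D : Type*) [Fintype D] [DecidableEq D] :
    ∑ r : D → ℤˣ, (1 / 2) ^ Fintype.card D * (∑ e, ((r e : ℤ) : ℝ)) ^ 4 =
      3 * (Fintype.card D : ℝ) ^ 2 - 2 * Fintype.card D := by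
  rw [← sum_fin_sum_pow_four]
  let e := Fintype.equivFin D
  refine Fintype.sum_equiv (Equiv.arrowCongr e (Equiv.refl ℤˣ)) _ _ fun r => ?_
  rw [← e.sum_comp]
  simp [Equiv.arrowCongr]

/-- The mean absolute value of a sum of `n` independent uniform signs. It is at least `√n / 4`
because the second moment is `n` while the fourth is at most `3 n ^ 2`. -/
theorem sqrt_card_le_sum_abs (D : Type*) [Fintype D] [DecidableEq D] [Nonempty D] :
    √(Fintype.card D) / 4 ≤
      ∑ r : D → ℤˣ, (1 / 2) ^ Fintype.card D * |∑ e, ((r e : ℤ) : ℝ)| := by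
  set n := Fintype.card D with hn
  have hnpos : (0 : ℝ) < n := by exact_mod_cast Fintype.card_pos
  set s := √(n : ℝ) with hs
  have hs0 : 0 < s := Real.sqrt_pos.mpr hnpos
  have hsn : s ^ 2 = n := Real.sq_sqrt hnpos.le
  have h2 := sum_sum_sq (D := D) (fun _ => 1)
  simp only [one_mul, one_pow, Finset.sum_const, Finset.card_univ, nsmul_eq_mul, mul_one,
    ← hn] at h2
  have h4 := sum_sum_pow_four D
  rw [← hn] at h4
  -- With `t = |x| / s` this reads `t ^ 2 / 2 - t ^ 4 / 12 ≤ t`; the constants make the mean of the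
  -- left-hand side positive when the second moment is `1` and the fourth at most `3`.
  have pt : ∀ x : ℝ, (6 * s ^ 2 * x ^ 2 - x ^ 4) / (12 * s ^ 3) ≤ |x| := by
    intro x
    rw [div_le_iff₀ (by positivity), ← sq_abs x, show x ^ 4 = |x| ^ 4 by
      rw [show 4 = 2 * 2 from rfl, pow_mul, pow_mul, sq_abs]]
    have ht := abs_nonneg x
    generalize |x| = t at ht
    -- A cubic with a double root near the minimum `t = √2 s` of `t ^ 3 - 6 s ^ 2 t`.
    have h1 : 0 ≤ (t - 3 / 2 * s) ^ 2 * (t + 3 * s) := by positivity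
    have h2 : 0 ≤ s ^ 2 * t := by positivity
    have h3 : 0 ≤ s ^ 3 := by positivity
    have : 0 ≤ t ^ 3 - 6 * s ^ 2 * t + 12 * s ^ 3 := by nlinarith
    nlinarith [mul_nonneg ht this]
  have key : ∑ r : D → ℤˣ, (1 / 2) ^ n *
      ((6 * s ^ 2 * (∑ e, ((r e : ℤ) : ℝ)) ^ 2 - (∑ e, ((r e : ℤ) : ℝ)) ^ 4) / (12 * s ^ 3)) =
      (6 * s ^ 2 * n - (3 * (n : ℝ) ^ 2 - 2 * n)) / (12 * s ^ 3) := by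
    rw [← h4, ← h2, Finset.mul_sum, ← Finset.sum_sub_distrib, Finset.sum_div]
    refine Finset.sum_congr rfl fun r _ => ?_
    ring
  calc s / 4 ≤ (6 * s ^ 2 * n - (3 * (n : ℝ) ^ 2 - 2 * n)) / (12 * s ^ 3) := by
        rw [← hsn, le_div_iff₀ (by positivity)]
        nlinarith [sq_nonneg s]
    _ = _ := key.symm
    _ ≤ _ := Finset.sum_le_sum fun r _ => mul_le_mul_of_nonneg_left (pt _) (by positivity)

/-- The correlation between a coordinate of a uniform sign vector and the sign of the sum of all
the coordinates, encoded as the mean absolute value of the sum divided by the number of coordinates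
(the two agree by `sum_signOf_sum_mul`). -/
noncomputable def majorityBias (D : Type*) [Fintype D] [DecidableEq D] : ℝ :=
  (∑ r : D → ℤˣ, (1 / 2) ^ Fintype.card D * |∑ e, ((r e : ℤ) : ℝ)|) / Fintype.card D

theorem le_majorityBias (D : Type*) [Fintype D] [DecidableEq D] [Nonempty D] :
    1 / (4 * √(Fintype.card D)) ≤ majorityBias D := by
  have hnpos : (0 : ℝ) < Fintype.card D := by exact_mod_cast Fintype.card_pos
  rw [majorityBias, le_div_iff₀ hnpos]
  refine le_trans (le_of_eq ?_) (sqrt_card_le_sum_abs D)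
  have hs0 : 0 < √(Fintype.card D : ℝ) := Real.sqrt_pos.mpr hnpos
  have hsn : √(Fintype.card D : ℝ) ^ 2 = Fintype.card D := Real.sq_sqrt hnpos.le
  field_simp
  rw [hsn]

section Sign

variable {D : Type*} [Fintype D] [DecidableEq D]

/-- All coordinates are equally correlated with the sign of the sum, by symmetry. -/
theorem sum_signOf_sum_mul (e : D) :
    ∑ r : D → ℤˣ, (1 / 2) ^ Fintype.card D *
      (signOf (∑ l, ((r l : ℤ) : ℝ)) * ((r e : ℤ) : ℝ)) = majorityBias D := by
  have hne : (Fintype.card D : ℝ) ≠ 0 := by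
    have : Nonempty D := ⟨e⟩
    exact_mod_cast Fintype.card_ne_zero
  set G : D → ℝ := fun e => ∑ r : D → ℤˣ, (1 / 2) ^ Fintype.card D *
    (signOf (∑ l, ((r l : ℤ) : ℝ)) * ((r e : ℤ) : ℝ)) with hG
  have hconst : ∀ e', G e' = G e := by
    intro e'
    refine Fintype.sum_equiv (Equiv.arrowCongr (Equiv.swap e e') (Equiv.refl ℤˣ)) _ _ fun r => ?_
    have h1 : ∑ l, ((r l : ℤ) : ℝ) = ∑ l, ((r (Equiv.swap e e' l) : ℤ) : ℝ) :=
      (_root_.Equiv.sum_comp (Equiv.swap e e') fun l => ((r l : ℤ) : ℝ)).symm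
    simp [Equiv.arrowCongr, h1]
  have hsum : ∑ e', G e' = ∑ r : D → ℤˣ, (1 / 2) ^ Fintype.card D * |∑ e, ((r e : ℤ) : ℝ)| := by
    simp only [hG]
    rw [Finset.sum_comm]
    refine Finset.sum_congr rfl fun r _ => ?_
    rw [← Finset.mul_sum, ← Finset.mul_sum, signOf_mul_self]
  change G e = _
  rw [majorityBias, ← hsum, eq_div_iff hne]
  simp [hconst, mul_comm]

/-- The substitution `r ↦ u * r` reduces the sign of `⟨u, r⟩` to the sign of the sum. -/
theorem sum_signOf_sum_mul_mul (u : D → ℤˣ) (e : D) :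
    ∑ r : D → ℤˣ, (1 / 2) ^ Fintype.card D *
      (signOf (∑ l, ((u l : ℤ) : ℝ) * ((r l : ℤ) : ℝ)) * ((r e : ℤ) : ℝ)) =
      majorityBias D * ((u e : ℤ) : ℝ) := by
  rw [← sum_signOf_sum_mul e, Finset.sum_mul]
  refine Fintype.sum_equiv (Equiv.mulLeft u) _ _ fun r => ?_
  have h : ((u e : ℤ) : ℝ) * ((u e : ℤ) : ℝ) = 1 := by
    rcases Int.units_eq_one_or (u e) with h | h <;> rw [h] <;> norm_num
  simp only [Equiv.coe_mulLeft, Pi.mul_apply, Units.val_mul, Int.cast_mul]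
  linear_combination (-(1 / 2) ^ Fintype.card D *
    (signOf (∑ l, ((u l : ℤ) : ℝ) * ((r l : ℤ) : ℝ)) * ((r e : ℤ) : ℝ))) * h

/-- The contribution of one block: the sign of `⟨u, r⟩`, known to the holder of `r`, times
`⟨V, r'⟩`, known to the holder of `r'`. -/
noncomputable def blockValue (u : D → ℤˣ) (V : D → ℝ) (z : (D → ℤˣ) × (D → ℤˣ)) : ℝ :=
  signOf (∑ l, ((u l : ℤ) : ℝ) * ((z.1 l : ℤ) : ℝ)) * ∑ l, V l * ((z.2 l : ℤ) : ℝ)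

theorem sum_pairWeight (ρ : ℝ) :
    ∑ z : (D → ℤˣ) × (D → ℤˣ), pairWeight ρ z.1 z.2 = 1 := by
  rw [Fintype.sum_prod_type]
  simp_rw [sum_pairWeight_right]
  simp

/-- The mean of a block is proportional to `⟨u, V⟩`. -/
theorem sum_pairWeight_mul_blockValue (ρ : ℝ) (u : D → ℤˣ) (V : D → ℝ) :
    ∑ z : (D → ℤˣ) × (D → ℤˣ), pairWeight ρ z.1 z.2 * blockValue u V z =
      ρ * majorityBias D * ∑ e, ((u e : ℤ) : ℝ) * V e := by
  rw [Fintype.sum_prod_type]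
  have inner : ∀ r : D → ℤˣ, ∑ r' : D → ℤˣ, pairWeight ρ r r' * blockValue u V (r, r') =
      ∑ e, ρ * V e * ((1 / 2) ^ Fintype.card D *
        (signOf (∑ l, ((u l : ℤ) : ℝ) * ((r l : ℤ) : ℝ)) * ((r e : ℤ) : ℝ))) := by
    intro r
    simp only [blockValue, Finset.mul_sum]
    rw [Finset.sum_comm]
    refine Finset.sum_congr rfl fun e _ => ?_
    have h := sum_pairWeight_mul ρ r e
    set S := signOf (∑ l, ((u l : ℤ) : ℝ) * ((r l : ℤ) : ℝ))
    calc _ = (S * V e) * ∑ r' : D → ℤˣ, pairWeight ρ r r' * ((r' e : ℤ) : ℝ) := by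
          rw [Finset.mul_sum]
          exact Finset.sum_congr rfl fun r' _ => by ring
      _ = _ := by rw [h]; ring
  simp_rw [inner]
  rw [Finset.sum_comm, Finset.mul_sum]
  refine Finset.sum_congr rfl fun e _ => ?_
  rw [← Finset.mul_sum, sum_signOf_sum_mul_mul]
  ring

theorem sum_pairWeight_mul_blockValue_sq (ρ : ℝ) (u : D → ℤˣ) (V : D → ℝ) :
    ∑ z : (D → ℤˣ) × (D → ℤˣ), pairWeight ρ z.1 z.2 * blockValue u V z ^ 2 = ∑ e, V e ^ 2 := by
  simp_rw [blockValue, mul_pow, signOf_sq, one_mul]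
  rw [Fintype.sum_prod_type, Finset.sum_comm]
  simp_rw [← Finset.sum_mul, sum_pairWeight_left]
  exact sum_sum_sq V

/-- Chebyshev's inequality for the sum of `T` independent blocks. -/
theorem chebyshev_blockValue {T : Type*} [Fintype T] [DecidableEq T] {ρ : ℝ} (h0 : 0 ≤ ρ)
    (h1 : ρ ≤ 1) (u : D → ℤˣ) (V : D → ℝ) {τ : ℝ} (hτ : 0 < τ)
    (E : (T → (D → ℤˣ) × (D → ℤˣ)) → Prop) [DecidablePred E]
    (hE : ∀ z, ¬ E z → τ ≤ |∑ j, blockValue u V (z j) -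
      Fintype.card T * (ρ * majorityBias D * ∑ e, ((u e : ℤ) : ℝ) * V e)|) :
    1 - Fintype.card T * (∑ e, V e ^ 2) / τ ^ 2 ≤
      ∑ z : T → (D → ℤˣ) × (D → ℤˣ), (∏ j, pairWeight ρ (z j).1 (z j).2) *
        (if E z then 1 else 0) := by
  set μ := ρ * majorityBias D * ∑ e, ((u e : ℤ) : ℝ) * V e with hμ
  set w : (D → ℤˣ) × (D → ℤˣ) → ℝ := fun z => pairWeight ρ z.1 z.2 with hw
  have hw1 : ∑ z, w z = 1 := sum_pairWeight ρ
  have hmean : ∑ z, w z * blockValue u V z = μ := sum_pairWeight_mul_blockValue ρ u V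
  have hsq : ∑ z, w z * blockValue u V z ^ 2 = ∑ e, V e ^ 2 :=
    sum_pairWeight_mul_blockValue_sq ρ u V
  have hcent : ∑ z, w z * (blockValue u V z - μ) = 0 := by
    simp_rw [mul_sub, Finset.sum_sub_distrib]
    rw [← Finset.sum_mul, hw1, hmean]; ring
  have hvar : ∑ z, w z * (blockValue u V z - μ) ^ 2 ≤ ∑ e, V e ^ 2 := by
    have : ∑ z, w z * (blockValue u V z - μ) ^ 2 =
        ∑ z, w z * blockValue u V z ^ 2 - 2 * μ * ∑ z, w z * blockValue u V z
          + μ ^ 2 * ∑ z, w z := by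
      rw [Finset.mul_sum, Finset.mul_sum, ← Finset.sum_sub_distrib, ← Finset.sum_add_distrib]
      exact Finset.sum_congr rfl fun z _ => by ring
    rw [this, hw1, hmean, hsq]
    nlinarith [sq_nonneg μ]
  have hprod1 : ∑ z : T → (D → ℤˣ) × (D → ℤˣ), ∏ j, w (z j) = 1 := by
    rw [← Fintype.prod_sum (fun _ ω => w ω)]
    simp [hw1]
  have hsecond := sum_pi_prod_mul_sum_sq (I := T) w hw1 (fun _ z => blockValue u V z - μ)
    (fun _ => hcent)
  have hsecond' : ∑ z : T → (D → ℤˣ) × (D → ℤˣ), (∏ j, w (z j)) *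
      (∑ j, (blockValue u V (z j) - μ)) ^ 2 ≤ Fintype.card T * ∑ e, V e ^ 2 := by
    rw [hsecond, Finset.sum_const, Finset.card_univ, nsmul_eq_mul]
    gcongr
  have pt : ∀ z : T → (D → ℤˣ) × (D → ℤˣ),
      (∏ j, w (z j)) - (∏ j, w (z j)) * (∑ j, (blockValue u V (z j) - μ)) ^ 2 / τ ^ 2 ≤
        (∏ j, w (z j)) * (if E z then 1 else 0) := by
    intro z
    have hnn : 0 ≤ ∏ j, w (z j) := Finset.prod_nonneg fun _ _ => pairWeight_nonneg h0 h1 _ _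
    rw [mul_div_assoc, ← mul_one_sub]
    refine mul_le_mul_of_nonneg_left ?_ hnn
    split_ifs with h
    · have : 0 ≤ (∑ j, (blockValue u V (z j) - μ)) ^ 2 / τ ^ 2 := by positivity
      linarith
    · have hz := hE z h
      rw [sub_nonpos, one_le_div (by positivity), Finset.sum_sub_distrib, Finset.sum_const,
        Finset.card_univ, nsmul_eq_mul, ← sq_abs (_ - _)]
      gcongr
  calc _ ≤ 1 - (∑ z : T → (D → ℤˣ) × (D → ℤˣ), (∏ j, w (z j)) *
      (∑ j, (blockValue u V (z j) - μ)) ^ 2) / τ ^ 2 := by gcongr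
    _ = ∑ z : T → (D → ℤˣ) × (D → ℤˣ), ((∏ j, w (z j)) -
      (∏ j, w (z j)) * (∑ j, (blockValue u V (z j) - μ)) ^ 2 / τ ^ 2) := by
        rw [Finset.sum_sub_distrib, hprod1, Finset.sum_div]
    _ ≤ _ := Finset.sum_le_sum fun z _ => pt z

end Sign

/-! ### Protocol trees -/

namespace Protocol

variable {A B : Type}

/-- The one-way protocol in which Alice sends `T` bits, after which Bob computes the output from
them and from what he sees. -/
def sendAll : (T : ℕ) → (msg : Fin T → A → Bool) → (out : (Fin T → Bool) → B → Bool) → Protocol A B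
  | 0, _, out => output (out Fin.elim0)
  | T + 1, msg, out =>
    alice (msg 0) fun t => sendAll T (fun j => msg j.succ) fun s => out (Fin.cons t s)

theorem oneWay_sendAll (T : ℕ) (msg : Fin T → A → Bool) (out : (Fin T → Bool) → B → Bool) :
    (sendAll T msg out).OneWay := by
  induction T with
  | zero => trivial
  | succ T ih => exact fun t => ih _ _

theorem bits_sendAll (T : ℕ) (msg : Fin T → A → Bool) (out : (Fin T → Bool) → B → Bool)
    (a : A) (b : B) : (sendAll T msg out).bits a b = T := by
  induction T with
  | zero => rfl
  | succ T ih => simp only [sendAll, bits, ih]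

theorem run_sendAll (T : ℕ) (msg : Fin T → A → Bool) (out : (Fin T → Bool) → B → Bool)
    (a : A) (b : B) : (sendAll T msg out).run a b = out (fun j => msg j a) b := by
  induction T with
  | zero => simp only [sendAll, run]; congr 1; exact Subsingleton.elim _ _
  | succ T ih =>
    simp only [sendAll, run, ih]
    congr 1
    exact Fin.cons_self_tail fun j => msg j a

/-- The indicator of the event that the output is `true` and at most `d` bits are sent. -/
def shortAccept (Q : Protocol A B) (d : ℕ) (a : A) (b : B) : ℝ :=
  if Q.run a b = true ∧ Q.bits a b ≤ d then 1 else 0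

/-- Each leaf at depth at most `d` defines a combinatorial rectangle, so that acceptance after at
most `d` bits is a sum of at most `2 ^ d` products of an indicator known to Alice and one known to
Bob. -/
theorem exists_shortAccept_eq_sum (Q : Protocol A B) (d : ℕ) :
    ∃ (ι : Type) (_ : Fintype ι) (_ : Nonempty ι) (U : ι → A → Bool) (V : ι → B → Bool),
      Fintype.card ι ≤ 2 ^ d ∧ ∀ a b, Q.shortAccept d a b =
        ∑ i, (if U i a then 1 else 0) * (if V i b then 1 else 0) := by
  induction d generalizing Q with
  | zero =>
    cases Q with
    | output out =>
      exact ⟨Unit, inferInstance, inferInstance, fun _ _ => true, fun _ => out, by simp,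
        fun a b => by simp [shortAccept, run, bits]⟩
    | alice msg next =>
      exact ⟨Unit, inferInstance, inferInstance, fun _ _ => false, fun _ _ => false, by simp,
        fun a b => by simp [shortAccept, bits]⟩
    | bob msg next =>
      exact ⟨Unit, inferInstance, inferInstance, fun _ _ => false, fun _ _ => false, by simp,
        fun a b => by simp [shortAccept, bits]⟩
  | succ d ih =>
    cases Q with
    | output out =>
      exact ⟨Unit, inferInstance, inferInstance, fun _ _ => true, fun _ => out,
        by simpa using Nat.one_le_two_pow, fun a b => by simp [shortAccept, run, bits]⟩
    | alice msg next =>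
      obtain ⟨ι₀, _, _, U₀, V₀, hc₀, h₀⟩ := ih (next false)
      obtain ⟨ι₁, _, _, U₁, V₁, hc₁, h₁⟩ := ih (next true)
      refine ⟨ι₀ ⊕ ι₁, inferInstance, inferInstance,
        Sum.elim (fun i a => !msg a && U₀ i a) (fun i a => msg a && U₁ i a),
        Sum.elim V₀ V₁, ?_, fun a b => ?_⟩
      · rw [Fintype.card_sum, pow_succ]; omega
      · have : (alice msg next).shortAccept (d + 1) a b =
            (next (msg a)).shortAccept d a b := by simp [shortAccept, run, bits]
        rw [this, Fintype.sum_sum_type]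
        cases hm : msg a <;> simp [hm, h₀, h₁, -mul_ite, -ite_mul] <;> rfl
    | bob msg next =>
      obtain ⟨ι₀, _, _, U₀, V₀, hc₀, h₀⟩ := ih (next false)
      obtain ⟨ι₁, _, _, U₁, V₁, hc₁, h₁⟩ := ih (next true)
      refine ⟨ι₀ ⊕ ι₁, inferInstance, inferInstance, Sum.elim U₀ U₁,
        Sum.elim (fun i b => !msg b && V₀ i b) (fun i b => msg b && V₁ i b), ?_, fun a b => ?_⟩
      · rw [Fintype.card_sum, pow_succ]; omega
      · have : (bob msg next).shortAccept (d + 1) a b =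
            (next (msg b)).shortAccept d a b := by simp [shortAccept, run, bits]
        rw [this, Fintype.sum_sum_type]
        cases hm : msg b <;> simp [hm, h₀, h₁, -mul_ite, -ite_mul] <;> rfl

end Protocol

/-! ### The one-way simulation -/

/-- With perfectly shared randomness, cutting a protocol of expected cost `k ≥ 1` off after `10 k`
bits costs at most `1 / 10` in the acceptance probability, by Markov's inequality. -/
theorem le_corrExpect_shortAccept {n m k : ℕ} (hk : 0 < k) {Q : RandProtocol n m}
    (hC : Q.CostLE 1 k) (x y : Fin n → Bool) :
    corrProb 1 m (fun r r' => Q.run (x, r) (y, r') = true) - 1 / 10 ≤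
      corrExpect 1 m fun r r' => Q.shortAccept (10 * k) (x, r) (y, r') := by
  have hk' : (0 : ℝ) < k := by exact_mod_cast hk
  have hbits := hC x y
  have hle : corrExpect 1 m (fun r r' => (Q.bits (x, r) (y, r') : ℝ) / (10 * k)) ≤ 1 / 10 := by
    rw [corrExpect_div, div_le_iff₀ (by positivity)]
    linarith
  refine le_trans (sub_le_sub_left hle _) ?_
  rw [corrProb, ← corrExpect_sub]
  refine corrExpect_mono zero_le_one le_rfl fun r r' => ?_
  have hnn : (0 : ℝ) ≤ (Q.bits (x, r) (y, r') : ℝ) / (10 * k) := by positivity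
  rw [Protocol.shortAccept]
  by_cases hrun : Q.run (x, r) (y, r') = true
  · by_cases hb : Q.bits (x, r) (y, r') ≤ 10 * k
    · simp only [hrun, hb, and_self, if_true]
      linarith
    · simp only [hrun, hb, and_false, if_true, if_false]
      rw [sub_nonpos, one_le_div (by positivity)]
      exact_mod_cast (not_le.mp hb).le
  · simp only [hrun, Bool.false_eq_true, false_and, if_false]
    linarith

/-- Cutting a protocol off never increases its acceptance probability. -/
theorem corrExpect_shortAccept_le {n m d : ℕ} (Q : RandProtocol n m) (x y : Fin n → Bool) :
    (corrExpect 1 m fun r r' => Q.shortAccept d (x, r) (y, r')) ≤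
      1 - corrProb 1 m fun r r' => Q.run (x, r) (y, r') = false := by
  have h1 : corrExpect 1 m (fun _ _ => 1) = 1 := corrExpect_const 1
  refine le_of_le_of_eq ?_ (congrArg (· - _) h1)
  rw [corrProb, ← corrExpect_sub]
  refine corrExpect_mono zero_le_one le_rfl fun r r' => ?_
  rw [Protocol.shortAccept]
  cases Q.run (x, r) (y, r') <;> simp
  split_ifs <;> norm_num

theorem corrProb_snd {ρ σ : ℝ} {m : ℕ} (E : (Fin m → ℤˣ) → Prop) :
    corrProb ρ m (fun _ r' => E r') = corrProb σ m fun _ r' => E r' := by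
  classical
  exact (corrExpect_snd fun r' => if E r' then 1 else 0).trans
    (corrExpect_snd fun r' => if E r' then 1 else 0).symm

/-- A protocol that never communicates needs no correlation, since its output depends on Bob's
string only. -/
theorem psrCC_zero_subset (ρ : ℝ) : psrCC 0 ⊆ owIsrCC ρ 1 := by
  intro P hP n
  obtain ⟨m, Q, hS, hC⟩ := hP n
  have hpos : ∀ f : (Fin m → ℤˣ) → (Fin m → ℤˣ) → ℕ,
      ¬ corrExpect 1 m (fun r r' => ((f r r' + 1 : ℕ) : ℝ)) ≤ (0 : ℕ) := by
    intro f h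
    have h1 : corrExpect 1 m (fun _ _ => 1) ≤ corrExpect 1 m
        (fun r r' => ((f r r' + 1 : ℕ) : ℝ)) :=
      corrExpect_mono zero_le_one le_rfl fun r r' => by
        push_cast
        linarith [(f r r').cast_nonneg (α := ℝ)]
    rw [corrExpect_const] at h1
    push_cast at h h1
    linarith
  cases Q with
  | alice msg next => exact absurd (hC (fun _ => true) (fun _ => true)) (hpos _)
  | bob msg next => exact absurd (hC (fun _ => true) (fun _ => true)) (hpos _)
  | output out =>
    refine ⟨m, .output out, trivial, ⟨fun x y h => ?_, fun x y h => ?_⟩, fun x y => ?_⟩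
    · exact (hS.1 x y h).trans_eq (corrProb_snd fun r' => out (y, r') = true)
    · exact (hS.2 x y h).trans_eq (corrProb_snd fun r' => out (y, r') = false)
    · simp only [Protocol.bits]
      rw [corrExpect_const]
      norm_num

/-- The simulation for functions of the form `2⁻ᵐ ⟨U x, V y⟩` with `U x` and `V y` vectors of `0`s
and `1`s: one-way communication of `T` bits distinguishes values at least `17 / 30` from values at
most `1 / 3`, once `T ≥ 1200 * L ^ 2 / ρ ^ 2` with `L` the ratio of the number of coordinates to
`2 ^ m`. -/
theorem exists_oneWay_of_inner {D : Type*} [Fintype D] [DecidableEq D] [Nonempty D]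
    {ρ : ℝ} (hρ : 0 < ρ) (hρ1 : ρ ≤ 1) {n m T : ℕ} {L : ℝ}
    (hD : (Fintype.card D : ℝ) ≤ 2 ^ m * L) (hT : 1200 * L ^ 2 ≤ T * ρ ^ 2) (hT0 : 0 < T)
    (U V : (Fin n → Bool) → D → Bool) (p : (Fin n → Bool) → (Fin n → Bool) → ℝ)
    (hp : ∀ x y, 2 ^ m * p x y = ∑ e, (if U x e then 1 else 0) * (if V y e then 1 else 0))
    (Y N : Set ((Fin n → Bool) × (Fin n → Bool)))
    (hY : ∀ x y, (x, y) ∈ Y → 17 / 30 ≤ p x y) (hN : ∀ x y, (x, y) ∈ N → p x y ≤ 1 / 3) :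
    ∃ (m' : ℕ) (Q : RandProtocol n m'), Q.OneWay ∧ Q.Solves ρ Y N ∧ Q.CostLE ρ T := by
  classical
  let e := Fintype.equivFin (Fin T × D)
  set M := Fintype.card (Fin T × D)
  let u : (Fin n → Bool) → D → ℤˣ := fun x l => if U x l then 1 else -1
  let v : (Fin n → Bool) → D → ℝ := fun y l => if V y l then 1 else 0
  set κ := majorityBias D with hκ
  -- Bob compares with the mean of the sum of the blocks at acceptance probability `9 / 20`.
  let θ : (Fin n → Bool) → ℝ := fun y => T * (ρ * κ * (2 * 2 ^ m * (9 / 20) - ∑ l, v y l))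
  let msg : Fin T → (Fin n → Bool) × (Fin M → ℤˣ) → Bool := fun j a =>
    decide (0 ≤ ∑ l, ((u a.1 l : ℤ) : ℝ) * ((a.2 (e (j, l)) : ℤ) : ℝ))
  let out : (Fin T → Bool) → (Fin n → Bool) × (Fin M → ℤˣ) → Bool := fun s b =>
    decide (θ b.1 ≤ ∑ j, (if s j then 1 else -1) * ∑ l, v b.1 l * ((b.2 (e (j, l)) : ℤ) : ℝ))
  have hrun : ∀ x y r r', (Protocol.sendAll T msg out).run (x, r) (y, r') =
      decide (θ y ≤ ∑ j, blockValue (u x) (v y)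
        (fun d => r (e (j, d)), fun d => r' (e (j, d)))) := by
    intro x y r r'
    rw [Protocol.run_sendAll]
    simp [out, msg, blockValue, signOf]
  have hinner : ∀ x y, ∑ l, ((u x l : ℤ) : ℝ) * v y l = 2 * (2 ^ m * p x y) - ∑ l, v y l := by
    intro x y
    rw [hp, Finset.mul_sum, ← Finset.sum_sub_distrib]
    refine Finset.sum_congr rfl fun l _ => ?_
    by_cases h : U x l = true <;> by_cases h' : V y l = true <;> simp [u, v, h, h']
    norm_num
  have hcard : (0 : ℝ) < Fintype.card D := by exact_mod_cast Fintype.card_pos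
  have hκ1 : 1 / (4 * √(Fintype.card D)) ≤ κ := le_majorityBias D
  have hκ0 : 0 < κ := lt_of_lt_of_le (by positivity) hκ1
  have hT0' : (0 : ℝ) < T := by exact_mod_cast hT0
  -- The two sides are at distance at least `7 / 60 > 1 / 10` from `9 / 20` in acceptance
  -- probability, and `⟨u, V⟩` changes at rate `2 * 2 ^ m` in it.
  set τ := T * (ρ * κ * (2 ^ m / 5)) with hτ
  have hτ0 : 0 < τ := by positivity
  have hv : ∀ y, ∑ l, v y l ^ 2 ≤ Fintype.card D := by
    intro y
    refine (Finset.sum_le_card_nsmul _ _ 1 fun l _ => ?_).trans (by simp)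
    simp only [v]
    split_ifs <;> norm_num
  have hbound : ∀ y, 2 / 3 ≤ 1 - Fintype.card (Fin T) * (∑ l, v y l ^ 2) / τ ^ 2 := by
    intro y
    have hκ2 : 1 ≤ 16 * Fintype.card D * κ ^ 2 := by
      have := pow_le_pow_left₀ (by positivity) hκ1 2
      rw [div_pow, mul_pow, Real.sq_sqrt hcard.le, div_le_iff₀ (by positivity)] at this
      linarith
    have hD2 : (Fintype.card D : ℝ) ^ 2 ≤ (2 ^ m) ^ 2 * L ^ 2 := by
      rw [← mul_pow]; gcongr
    have h1 : 1200 * (Fintype.card D : ℝ) ^ 2 ≤ (2 ^ m) ^ 2 * (T * ρ ^ 2) := by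
      calc _ ≤ 1200 * ((2 ^ m) ^ 2 * L ^ 2) := by gcongr
        _ = (2 ^ m) ^ 2 * (1200 * L ^ 2) := by ring
        _ ≤ _ := by gcongr
    have h2 : 3 * (T * Fintype.card D) ≤ τ ^ 2 := by
      have h3 := mul_le_mul_of_nonneg_left h1
        (show 0 ≤ T * κ ^ 2 / 25 by positivity)
      have h4 : T * κ ^ 2 / 25 * ((2 ^ m) ^ 2 * (T * ρ ^ 2)) = τ ^ 2 := by rw [hτ]; ring
      rw [h4] at h3
      refine le_trans ?_ h3
      have h5 := mul_le_mul_of_nonneg_left hκ2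
        (show 0 ≤ 3 * ((T : ℝ) * Fintype.card D) by positivity)
      linarith
    rw [Fintype.card_fin]
    have : T * (∑ l, v y l ^ 2) / τ ^ 2 ≤ 1 / 3 := by
      rw [div_le_iff₀ (by positivity)]
      have := mul_le_mul_of_nonneg_left (hv y) hT0'.le
      linarith
    linarith
  refine ⟨M, Protocol.sendAll T msg out, Protocol.oneWay_sendAll _ _ _,
    ⟨fun x y h => ?_, fun x y h => ?_⟩, fun x y => ?_⟩
  · have hpxy := hY x y h
    refine (hbound y).trans ((chebyshev_blockValue hρ.le hρ1 (u x) (v y) hτ0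
      (fun z => θ y ≤ ∑ j, blockValue (u x) (v y) (z j)) fun z hz => ?_).trans_eq ?_)
    · rw [hinner, Fintype.card_fin]
      refine le_trans ?_ (neg_le_abs _)
      have h1 : 0 ≤ T * (ρ * κ * 2 ^ m) * (p x y - 17 / 30) :=
        mul_nonneg (by positivity) (by linarith)
      have h2 : 0 ≤ T * (ρ * κ * 2 ^ m) := by positivity
      simp only [θ, not_le] at hz
      rw [hτ]
      nlinarith
    · rw [← corrExpect_blocks e, corrProb]
      simp only [hrun, decide_eq_true_eq]
  · have hpxy := hN x y h
    refine (hbound y).trans ((chebyshev_blockValue hρ.le hρ1 (u x) (v y) hτ0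
      (fun z => ¬ θ y ≤ ∑ j, blockValue (u x) (v y) (z j)) fun z hz => ?_).trans_eq ?_)
    · rw [hinner, Fintype.card_fin]
      refine le_trans ?_ (le_abs_self _)
      have h1 : 0 ≤ T * (ρ * κ * 2 ^ m) * (1 / 3 - p x y) :=
        mul_nonneg (by positivity) (by linarith)
      have h2 : 0 ≤ T * (ρ * κ * 2 ^ m) := by positivity
      simp only [θ, not_not] at hz
      rw [hτ]
      nlinarith
    · rw [← corrExpect_blocks e, corrProb]
      simp only [hrun, decide_eq_false_iff_not]
  · simp only [Protocol.bits_sendAll]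
    rw [corrExpect_const]

/-- A two-way protocol of expected cost `k ≥ 1` with shared randomness is simulated by `T` bits
sent by Alice with `ρ`-correlated randomness, once `T ≥ 1200 * 4 ^ (10 * k) / ρ ^ 2`. -/
theorem exists_oneWay {ρ : ℝ} (hρ : 0 < ρ) (hρ1 : ρ ≤ 1) {n m k T : ℕ} (hk : 0 < k)
    (hT : 1200 * ((2 : ℝ) ^ (10 * k)) ^ 2 ≤ T * ρ ^ 2) (Q : RandProtocol n m)
    (Y N : Set ((Fin n → Bool) × (Fin n → Bool))) (hS : Q.Solves 1 Y N) (hC : Q.CostLE 1 k) :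
    ∃ (m' : ℕ) (Q' : RandProtocol n m'), Q'.OneWay ∧ Q'.Solves ρ Y N ∧ Q'.CostLE ρ T := by
  classical
  obtain ⟨ι, _, _, U, V, hι, hUV⟩ := Q.exists_shortAccept_eq_sum (10 * k)
  have hT0 : 0 < T := by
    rcases Nat.eq_zero_or_pos T with rfl | h
    · have : (0 : ℝ) < 1200 * ((2 : ℝ) ^ (10 * k)) ^ 2 := by positivity
      simp only [Nat.cast_zero, zero_mul] at hT
      linarith
    · exact h
  refine exists_oneWay_of_inner (D := (Fin m → ℤˣ) × ι) (m := m) (L := 2 ^ (10 * k)) hρ hρ1 ?_ hT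
    hT0 (fun x l => U l.2 (x, l.1)) (fun y l => V l.2 (y, l.1))
    (fun x y => corrExpect 1 m fun r r' => Q.shortAccept (10 * k) (x, r) (y, r')) ?_ Y N ?_ ?_
  · have hι' : (Fintype.card ι : ℝ) ≤ 2 ^ (10 * k) := by exact_mod_cast hι
    simp only [Fintype.card_prod, Fintype.card_fun, Fintype.card_units_int, Fintype.card_fin]
    push_cast
    gcongr
  · intro x y
    rw [corrExpect_one, Finset.mul_sum, Fintype.sum_prod_type]
    refine Finset.sum_congr rfl fun r _ => ?_
    rw [← mul_assoc, ← mul_pow, hUV]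
    norm_num
  · intro x y h
    have h1 := le_corrExpect_shortAccept hk hC x y
    have h2 := hS.1 x y h
    linarith
  · intro x y h
    have h1 := corrExpect_shortAccept_le (d := 10 * k) Q x y
    have h2 := hS.2 x y h
    linarith

end CommCC

theorem mainTheorem3 (ρ : ℝ) (hρ : 0 < ρ) (hρ1 : ρ ≤ 1) :
    ∃ c : ℕ, ∀ k : ℕ, CommCC.psrCC k ⊆ CommCC.owIsrCC ρ (c ^ k) := by
  refine ⟨⌈1200 / ρ ^ 2⌉₊ * 4 ^ 10, fun k => ?_⟩
  rcases Nat.eq_zero_or_pos k with rfl | hk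
  · simpa using CommCC.psrCC_zero_subset ρ
  intro P hP n
  obtain ⟨m, Q, hS, hC⟩ := hP n
  refine CommCC.exists_oneWay hρ hρ1 hk ?_ Q _ _ hS hC
  set C := ⌈1200 / ρ ^ 2⌉₊
  have hC1 : 1200 ≤ (C : ℝ) * ρ ^ 2 := (div_le_iff₀ (by positivity)).mp (Nat.le_ceil _)
  have hC0 : 1 ≤ C := Nat.one_le_iff_ne_zero.mpr (Nat.ceil_pos.mpr (by positivity)).ne'
  have hCk : (C : ℝ) ≤ (C : ℝ) ^ k := by exact_mod_cast Nat.le_self_pow hk.ne' C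
  push_cast
  have h4 : ((2 : ℝ) ^ (10 * k)) ^ 2 = (4 ^ 10) ^ k := by
    rw [← pow_mul, ← pow_mul, mul_comm (10 * k) 2, pow_mul]; norm_num
  rw [h4, mul_pow]
  calc (1200 : ℝ) * (4 ^ 10) ^ k ≤ (C * ρ ^ 2) * (4 ^ 10) ^ k := by gcongr
    _ ≤ (C ^ k * ρ ^ 2) * (4 ^ 10) ^ k := by gcongr
    _ = _ := by ring
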